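/- Let $p$ be a prime, let $F$ be a field of characteristic $p$, and let $\mathcal{D}=F(x)[\tau]$ be the ring of operators $\sum_i a_i(x)\tau^i$ with multiplication determined by $\tau\, f(x)=f(x+1)\,\tau$; let $\mathcal{P}=F[x][\tau]\subset\mathcal{D}$. For a nonzero $A=\sum_{i=0}^n a_i(x)\tau^i\in\mathcal{D}$ with $a_n\neq 0$ put $\mathrm{lc}(A)=a_n(x-n)$. For a nonzero $L\in\mathcal{P}$ the set $$\mathcal{I}_\infty(L)=\{0\}\cup\{\mathrm{lc}(AL) : A\in\mathcal{D},\ AL\in\mathcal{P},\ AL\neq 0\}$$ is an ideal of $F[x]$; let $\mathfrak{lc}_\infty(L)\in F[x]$ be its monic generator (the essential part of the leading coefficient of $L$; its roots are the true singularities of $L$, with multiplicity). Let $\chi(L)\in F(x)[T]$ be the characteristic polynomial of the $p$-curvature of $L$, that is, of the $F(x)$-linear map $v\mapsto \tau^p v$ on the finite-dimensional $F(x)$-vector space $\mathcal{D}/\mathcal{D}L$. Put $Z=x^p-x$, and for $f\in F[x]$ put $\mathcal{N}(f)=f(x)f(x+1)\cdots f(x+p-1)$. Theorem. For every nonzero $L\in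 F[x][\tau]$, the polynomial $\chi(L)$ lies in $F(Z)[T]$, and its monic denominator, i.e. the monic $c\in F[Z]$ of least degree in $Z$ with $c\cdot\chi(L)\in F[Z][T]$, is $$\mathrm{denom}(\chi(L))=\mathcal{N}(\mathfrak{lc}_\infty(L)).$$ -/

import Mathlib

/-!
Recurrence (shift) operators over a field `F`, their `p`-curvature, and the essential part of
their leading coefficient.  `F(x)` is `RatFunc F`, `F[x]` is `Polynomial F`.
-/

noncomputable section

namespace ShiftOperator

open Polynomial Multiplicative

/-! ### The shift and the rings of operators -/

/-- The shift automorphism `f(x) ↦ f(x + 1)` of `F(x)`; it extends the automorphism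
`Polynomial.taylorEquiv 1` of `F[x]`. -/
def shift (F : Type*) [Field F] : RatFunc F ≃ₐ[F] RatFunc F :=
  IsFractionRing.fieldEquivOfAlgEquiv F (RatFunc F) (RatFunc F) (taylorEquiv (1 : F))

/-- The additive monoid `ℕ` acts on `F(x)` by `n • f(x) = f(x + n)`. -/
instance shiftAction (F : Type*) [Field F] :
    MulSemiringAction (Multiplicative ℕ) (RatFunc F) :=
  MulSemiringAction.compHom (RatFunc F) (powersHom (RatFunc F ≃ₐ[F] RatFunc F) (shift F))

/-- The ring `F(x)[τ]` of operators `∑ aᵢ τ^i`, with multiplication determined by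
`τ f(x) = f(x + 1) τ`; the operator `τ` is `SkewPolynomial.X`. -/
abbrev Op (F : Type*) [Field F] : Type _ := SkewPolynomial (RatFunc F)

/-- The operator `τ`. -/
def tau (F : Type*) [Field F] : Op F := SkewPolynomial.X

section
variable {F : Type*} [Field F]

theorem shift_algebraMap (f : F[X]) :
    shift F (algebraMap F[X] (RatFunc F) f) = algebraMap F[X] (RatFunc F) (f.comp (X + C 1)) :=
  IsFractionRing.fieldEquivOfAlgEquiv_algebraMap F (RatFunc F) (RatFunc F)
    (taylorEquiv (1 : F)) f

theorem shift_pow_algebraMap (n : ℕ) (f : F[X]) :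
    (shift F ^ n) (algebraMap F[X] (RatFunc F) f) =
      algebraMap F[X] (RatFunc F) (f.comp (X + C (n : F))) := by
  induction n with
  | zero => simp
  | succ n ih =>
    rw [pow_succ', AlgEquiv.mul_apply, ih, shift_algebraMap, comp_assoc]
    congr 2
    simp [add_assoc, add_comm]

theorem phi_iterate (n : ℕ) (f : RatFunc F) :
    ((SkewPolynomial.φ : RatFunc F →+* RatFunc F)^[n]) f = (shift F ^ n) f := by
  rw [SkewPolynomial.φ_iterate_apply]
  rfl

theorem tau_pow (n : ℕ) : tau F ^ n = SkewPolynomial.monomial n 1 :=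
  (SkewPolynomial.monomial_one_right_eq_X_pow n).symm

theorem tau_pow_mul_C (n : ℕ) (f : RatFunc F) :
    tau F ^ n * SkewPolynomial.C f = SkewPolynomial.C ((shift F ^ n) f) * tau F ^ n := by
  rw [tau_pow, SkewPolynomial.monomial_mul_C, SkewPolynomial.C_mul_monomial, phi_iterate,
    one_mul, mul_one]

theorem tau_mul_C (f : RatFunc F) :
    tau F * SkewPolynomial.C f = SkewPolynomial.C (shift F f) * tau F := by
  simpa using tau_pow_mul_C 1 f

theorem smul_eq_C_mul' (f : RatFunc F) (A : Op F) : f • A = SkewPolynomial.C f * A := by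
  rw [← one_mul A, ← smul_mul_assoc, ← SkewPolynomial.monomial_zero_one,
    SkewPolynomial.smul_monomial, smul_eq_mul, mul_one, SkewPolynomial.monomial_zero_left,
    SkewPolynomial.monomial_zero_left, SkewPolynomial.C_1, one_mul]

theorem coeff_C_mul' (f : RatFunc F) (A : Op F) (i : ℕ) :
    (SkewPolynomial.C f * A).coeff i = f * A.coeff i :=
  (SkewMonoidAlgebra.coeff_single_one_mul A f (ofAdd i))

theorem coeff_tau_pow_mul (k : ℕ) (A : Op F) (i : ℕ) :
    (tau F ^ k * A).coeff (k + i) = (shift F ^ k) (A.coeff i) := by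
  rw [tau_pow]
  have := SkewMonoidAlgebra.coeff_single_mul_aux A (r := (1 : RatFunc F)) (x := ofAdd k)
    (y := ofAdd (k + i)) (z := ofAdd i)
    (by intro a; rw [ofAdd_add]; exact mul_right_inj _)
  rw [one_mul] at this
  exact this

theorem coeff_tau_pow_mul_of_lt (k : ℕ) (A : Op F) (i : ℕ) (h : i < k) :
    (tau F ^ k * A).coeff i = 0 := by
  rw [tau_pow]
  refine SkewMonoidAlgebra.coeff_single_mul_of_not_exists_mul (1 : RatFunc F) A ?_
  rintro ⟨d, hd⟩
  have : i = k + toAdd d := congrArg toAdd hd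
  omega

/-- `A` lies in `F[x][τ]`, i.e. all its coefficients are polynomials. -/
def IsPoly (A : Op F) : Prop :=
  ∀ i : ℕ, ∃ f : F[X], algebraMap F[X] (RatFunc F) f = A.coeff i

/-- The order of an operator, i.e. its degree in `τ` (with value `0` for the zero operator). -/
def ord (A : Op F) : ℕ := A.support.sup id

/-- The leading coefficient `aₙ(x - n)`, in the convention `A = ∑_{i ≤ n} τ^i aᵢ(x - i)`, of an
operator `A = ∑_{i ≤ n} aᵢ(x) τ^i` of order `n` (not normalised to be monic). -/
def lc (A : Op F) : RatFunc F :=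
  ((shift F ^ ord A)⁻¹ : RatFunc F ≃ₐ[F] RatFunc F) (A.coeff (ord A))

theorem coeff_ord_ne_zero {A : Op F} (hA : A ≠ 0) : A.coeff (ord A) ≠ 0 := by
  have hne : A.support.Nonempty := by
    rw [Finset.nonempty_iff_ne_empty]
    simpa using hA
  obtain ⟨i, hi, h⟩ := Finset.exists_mem_eq_sup A.support hne id
  rw [ord, h]
  simpa using hi

theorem coeff_eq_zero_of_ord_lt {A : Op F} {i : ℕ} (h : ord A < i) : A.coeff i = 0 := by
  by_contra hi
  exact absurd (Finset.le_sup (f := id) (SkewPolynomial.mem_support_iff.2 hi)) (not_le.2 h)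

theorem ord_eq {A : Op F} {m : ℕ} (hm : A.coeff m ≠ 0) (h : ∀ i, m < i → A.coeff i = 0) :
    ord A = m := by
  have hA : A ≠ 0 := by
    rintro rfl
    simp at hm
  apply le_antisymm
  · by_contra hlt
    exact coeff_ord_ne_zero hA (h _ (not_le.1 hlt))
  · by_contra hlt
    exact hm (coeff_eq_zero_of_ord_lt (not_le.1 hlt))

/-! ### The essential part of the leading coefficient -/

/-- `a` is zero, or the leading coefficient `lc (A L)` of a nonzero left multiple of `L` with
polynomial coefficients, where `A` is any operator in `F(x)[τ]`. -/
def IsMultipleLC (L : Op F) (a : F[X]) : Prop :=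
  a = 0 ∨ ∃ A : Op F, IsPoly (A * L) ∧ A * L ≠ 0 ∧ algebraMap F[X] (RatFunc F) a = lc (A * L)

theorem isMultipleLC_iff (L : Op F) (a : F[X]) :
    IsMultipleLC L a ↔ ∃ (A : Op F) (m : ℕ), IsPoly (A * L) ∧
      (∀ i, m < i → (A * L).coeff i = 0) ∧
      (A * L).coeff m = (shift F ^ m) (algebraMap F[X] (RatFunc F) a) := by
  constructor
  · rintro (rfl | ⟨A, hA, -, h⟩)
    · exact ⟨0, 0, fun i => ⟨0, by simp⟩, by simp, by simp⟩
    · refine ⟨A, ord (A * L), hA, fun i hi => coeff_eq_zero_of_ord_lt hi, ?_⟩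
      rw [h, lc, ← AlgEquiv.mul_apply, mul_inv_cancel, AlgEquiv.one_apply]
  · rintro ⟨A, m, hA, hm, h⟩
    by_cases ha : a = 0
    · exact Or.inl ha
    · have hne : (A * L).coeff m ≠ 0 := by
        rw [h]
        exact (map_ne_zero_iff _ (AlgEquiv.injective _)).2
          ((map_ne_zero_iff _ (RatFunc.algebraMap_injective F)).2 ha)
      have ho := ord_eq hne hm
      refine Or.inr ⟨A, hA, ?_, ?_⟩
      · intro h0
        rw [h0] at hne
        simp at hne
      · rw [lc, ho, h, ← AlgEquiv.mul_apply, inv_mul_cancel, AlgEquiv.one_apply]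

theorem IsPoly.tau_pow_mul {A : Op F} (hA : IsPoly A) (k : ℕ) : IsPoly (tau F ^ k * A) := by
  intro i
  rcases lt_or_ge i k with h | h
  · exact ⟨0, by rw [coeff_tau_pow_mul_of_lt k A i h, map_zero]⟩
  · obtain ⟨j, rfl⟩ := Nat.exists_eq_add_of_le h
    obtain ⟨f, hf⟩ := hA j
    exact ⟨f.comp (X + C (k : F)), by rw [coeff_tau_pow_mul, ← hf, shift_pow_algebraMap]⟩

/-- The witnessing degree can be raised, by multiplying with a power of `τ`. -/
theorem exists_of_le {L : Op F} {a : F[X]} {A : Op F} {m : ℕ} (hA : IsPoly (A * L))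
    (hm : ∀ i, m < i → (A * L).coeff i = 0)
    (h : (A * L).coeff m = (shift F ^ m) (algebraMap F[X] (RatFunc F) a)) (k : ℕ) :
    ∃ A' : Op F, IsPoly (A' * L) ∧ (∀ i, k + m < i → (A' * L).coeff i = 0) ∧
      (A' * L).coeff (k + m) = (shift F ^ (k + m)) (algebraMap F[X] (RatFunc F) a) := by
  refine ⟨tau F ^ k * A, ?_, ?_, ?_⟩
  · rw [mul_assoc]
    exact hA.tau_pow_mul k
  · intro i hi
    obtain ⟨j, rfl⟩ := Nat.exists_eq_add_of_le (show k ≤ i by omega)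
    rw [mul_assoc, coeff_tau_pow_mul, hm j (by omega), map_zero]
  · rw [mul_assoc, coeff_tau_pow_mul, h, pow_add, AlgEquiv.mul_apply]

/-- The ideal `I_∞` of `F[x]`, consisting of `0` and the leading coefficients of the nonzero left
multiples of `L` with polynomial coefficients. -/
def lcIdeal (L : Op F) : Ideal F[X] where
  carrier := {a | IsMultipleLC L a}
  zero_mem' := Or.inl rfl
  add_mem' := by
    intro a b ha hb
    obtain ⟨A, m, hA, hm, h⟩ := (isMultipleLC_iff L a).1 ha
    obtain ⟨B, n, hB, hn, h'⟩ := (isMultipleLC_iff L b).1 hb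
    obtain ⟨A', hA', hm', e⟩ := exists_of_le hA hm h n
    obtain ⟨B', hB', hn', e'⟩ := exists_of_le hB hn h' m
    rw [add_comm m n] at hn' e'
    refine (isMultipleLC_iff L _).2 ⟨A' + B', n + m, ?_, ?_, ?_⟩
    · intro i
      obtain ⟨f, hf⟩ := hA' i
      obtain ⟨g, hg⟩ := hB' i
      exact ⟨f + g, by rw [map_add, hf, hg, add_mul, SkewPolynomial.coeff_add]⟩
    · intro i hi
      rw [add_mul, SkewPolynomial.coeff_add, hm' i hi, hn' i hi, add_zero]
    · rw [add_mul, SkewPolynomial.coeff_add, e, e', map_add, map_add]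
  smul_mem' := by
    intro c a ha
    obtain ⟨A, m, hA, hm, h⟩ := (isMultipleLC_iff L a).1 ha
    refine (isMultipleLC_iff L _).2
      ⟨SkewPolynomial.C ((shift F ^ m) (algebraMap F[X] (RatFunc F) c)) * A, m, ?_, ?_, ?_⟩
    · intro i
      obtain ⟨f, hf⟩ := hA i
      exact ⟨c.comp (X + C (m : F)) * f, by
        rw [mul_assoc, coeff_C_mul', map_mul, hf, shift_pow_algebraMap]⟩
    · intro i hi
      rw [mul_assoc, coeff_C_mul', hm i hi, mul_zero]
    · rw [mul_assoc, coeff_C_mul', h, smul_eq_mul, map_mul, map_mul]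

/-- The monic generator of an ideal of `F[x]` (and `0` for the zero ideal). -/
def monicGenerator (I : Ideal F[X]) : F[X] :=
  Submodule.IsPrincipal.generator I * C (Submodule.IsPrincipal.generator I).leadingCoeff⁻¹

/-- The essential part of the leading coefficient of `L`: the monic generator of `I_∞`. -/
def essentialLC (L : Op F) : F[X] := monicGenerator (lcIdeal L)

/-! ### The characteristic polynomial of the `p`-curvature -/

theorem shift_pow_char (p : ℕ) [CharP F p] : shift F ^ p = 1 := by
  ext f
  obtain ⟨a, b, -, rfl⟩ := IsFractionRing.div_surjective F[X] f
  rw [map_div₀, shift_pow_algebraMap, shift_pow_algebraMap]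
  simp

/-- The `p`-curvature of an `F(x)[τ]`-module `M`, with `F` of characteristic `p`: the
`F(x)`-linear endomorphism of `M` given by the action of `T = τ^p`. -/
def pCurvature (p : ℕ) [CharP F p] (M : Type*) [AddCommGroup M] [Module (Op F) M]
    [Module (RatFunc F) M] [IsScalarTower (RatFunc F) (Op F) M] : M →ₗ[RatFunc F] M where
  toFun v := tau F ^ p • v
  map_add' := smul_add _
  map_smul' f v := by
    have e : ∀ w : M, f • w = (SkewPolynomial.C f : Op F) • w := fun w => by
      rw [← mul_one (SkewPolynomial.C f : Op F), ← smul_eq_C_mul', smul_assoc, one_smul]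
    rw [e, RingHom.id_apply, e, smul_smul, smul_smul, tau_pow_mul_C, shift_pow_char,
      AlgEquiv.one_apply]

/-- The left `F(x)[τ]`-module `F(x)[τ] / F(x)[τ] L`. -/
abbrev QuotientModule (L : Op F) : Type _ := Op F ⧸ Submodule.span (Op F) {L}

theorem finite_quotientModule {L : Op F} (hL : L ≠ 0) :
    Module.Finite (RatFunc F) (QuotientModule L) := by
  set π : Op F →ₗ[Op F] QuotientModule L := (Submodule.span (Op F) {L}).mkQ with hπ
  have hπs : ∀ (f : RatFunc F) (A : Op F), π (f • A) = f • π A := fun f A => rfl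
  set N : Submodule (RatFunc F) (QuotientModule L) := Submodule.span (RatFunc F)
    ((fun i => π (tau F ^ i)) '' (Finset.range (ord L) : Set ℕ)) with hN
  have key : ∀ m, π (tau F ^ m) ∈ N := by
    intro m
    induction m using Nat.strong_induction_on with
    | _ m ih =>
      rcases lt_or_ge m (ord L) with h | h
      · exact Submodule.subset_span ⟨m, by simpa using h, rfl⟩
      · obtain ⟨k, rfl⟩ := Nat.exists_eq_add_of_le' h
        have hexp : tau F ^ k * L =
            ∑ i ∈ Finset.range (ord L + 1), (shift F ^ k) (L.coeff i) • tau F ^ (k + i) := by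
          ext j
          have hsum : ∀ s : Finset ℕ, (∑ i ∈ s, (shift F ^ k) (L.coeff i) • tau F ^ (k + i) :
              Op F).coeff j = ∑ i ∈ s, if k + i = j then (shift F ^ k) (L.coeff i) else 0 := by
            intro s
            induction s using Finset.induction_on with
            | empty => simp
            | insert a s ha ihs =>
              rw [Finset.sum_insert ha, Finset.sum_insert ha, SkewPolynomial.coeff_add, ihs,
                tau_pow, SkewPolynomial.smul_monomial, SkewPolynomial.coeff_monomial,
                smul_eq_mul, mul_one]
          rw [hsum]
          rcases lt_or_ge j k with hj | hj
          · rw [coeff_tau_pow_mul_of_lt k L j hj, Finset.sum_eq_zero]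
            intro i _
            rw [if_neg (by omega)]
          · obtain ⟨l, rfl⟩ := Nat.exists_eq_add_of_le hj
            rw [coeff_tau_pow_mul]
            simp only [add_right_inj, Finset.sum_ite_eq', Finset.mem_range]
            split_ifs with hl
            · rfl
            · rw [coeff_eq_zero_of_ord_lt (by omega), map_zero]
        have h0 : π (tau F ^ k * L) = 0 := by
          rw [hπ, Submodule.mkQ_apply, Submodule.Quotient.mk_eq_zero]
          exact Submodule.smul_mem _ _ (Submodule.mem_span_singleton_self L)
        rw [hexp, Finset.sum_range_succ, map_add, map_sum, hπs] at h0
        have hmem : (shift F ^ k) (L.coeff (ord L)) • π (tau F ^ (k + ord L)) ∈ N := by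
          rw [eq_neg_of_add_eq_zero_right h0]
          refine N.neg_mem (N.sum_mem fun i hi => ?_)
          rw [hπs]
          exact N.smul_mem _ (ih _ (by have := Finset.mem_range.1 hi; omega))
        have hne : (shift F ^ k) (L.coeff (ord L)) ≠ 0 :=
          (map_ne_zero_iff _ (AlgEquiv.injective _)).2 (coeff_ord_ne_zero hL)
        exact (N.smul_mem_iff hne).1 hmem
  have htop : N = ⊤ := by
    rw [eq_top_iff]
    rintro v -
    obtain ⟨A, rfl⟩ := Submodule.mkQ_surjective _ v
    change π A ∈ N
    rw [← SkewPolynomial.sum_monomial A, SkewPolynomial.sum_def, map_sum]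
    refine N.sum_mem fun i _ => ?_
    rw [← SkewPolynomial.smul_X_eq_monomial]
    exact N.smul_mem _ (key i)
  exact ⟨Submodule.fg_def.2 ⟨_, (Finset.finite_toSet _).image _, htop⟩⟩

/-- `χ(L) ∈ F(x)[T]`, the characteristic polynomial of the `p`-curvature of the (finite
dimensional) module `F(x)[τ] / F(x)[τ] L`, for `L ≠ 0`. -/
def chi (p : ℕ) [CharP F p] (L : Op F) (hL : L ≠ 0) : (RatFunc F)[X] :=
  haveI := finite_quotientModule hL
  (pCurvature p (QuotientModule L)).charpoly

/-! ### Norms and denominators -/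

/-- `f(x) f(x + 1) ⋯ f(x + p - 1)`. -/
def shiftNorm (p : ℕ) (f : F[X]) : F[X] := ∏ i ∈ Finset.range p, f.comp (X + C (i : F))

/-- The ideal of all `c ∈ F[Z]` such that `c q` has coefficients in `F[Z]`. -/
def denomIdeal (q : (RatFunc F)[X]) : Ideal F[X] where
  carrier := {c | ∃ r : F[X][X],
    C (algebraMap F[X] (RatFunc F) c) * q = r.map (algebraMap F[X] (RatFunc F))}
  zero_mem' := ⟨0, by simp⟩
  add_mem' := by
    rintro a b ⟨r, hr⟩ ⟨s, hs⟩
    exact ⟨r + s, by rw [map_add, map_add, add_mul, hr, hs, Polynomial.map_add]⟩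
  smul_mem' := by
    rintro c a ⟨r, hr⟩
    exact ⟨C c * r, by
      rw [smul_eq_mul, map_mul, map_mul, mul_assoc, hr, Polynomial.map_mul, Polynomial.map_C]⟩

/-- The monic denominator of a polynomial `q` with coefficients in a rational function field
`F(Z)`: the monic polynomial in `F[Z]` of least degree whose product with `q` has coefficients
in `F[Z]`. -/
def denom (q : (RatFunc F)[X]) : F[X] := monicGenerator (denomIdeal q)

theorem comp_injective (p : ℕ) [hp : Fact p.Prime] :
    Function.Injective (compRingHom (X ^ p - X : F[X])) := by
  rw [injective_iff_map_eq_zero]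
  intro f hf
  have hd : (X ^ p - X : F[X]).natDegree = p :=
    FiniteField.X_pow_card_sub_X_natDegree_eq F hp.out.one_lt
  rcases comp_eq_zero_iff.1 hf with h | ⟨-, h⟩
  · exact h
  · have := congrArg natDegree h
    rw [hd, natDegree_C] at this
    exact absurd this hp.out.ne_zero

/-- The embedding `F(Z) → F(x)`, `Z ↦ x^p - x`, of rational function fields. -/
def embedZ (F : Type*) [Field F] (p : ℕ) [Fact p.Prime] : RatFunc F →+* RatFunc F :=
  RatFunc.mapRingHom (compRingHom (X ^ p - X : F[X]))
    (nonZeroDivisors_le_comap_nonZeroDivisors_of_injective _ (comp_injective p))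

end

end ShiftOperator

end

/-! Let `V` be the quotient module and `M n` (`spanLT`) the `F[x]`-span in `V` of the classes of
`τ^i`, `i < n`. A relation `a(x + m) τ^m ∈ M m` is the same as a left multiple of `L` with
polynomial coefficients and leading coefficient `a`, so these `a`, for varying `m`, form `I_∞`
(`mem_lcIdeal_iff`). For fixed `m` they form ideals that increase with `m`, hence are constant from
some `n` on. From there `M (m + 1) / M m` is cyclic with annihilator generated by `f(x + m)`, where
`f` is the essential leading coefficient. So `M n ⊆ M (n + p)` has determinant `f(x + n) ⋯ f(x + n +
p - 1)` (`hasIndex_spanLT`), which is the norm of `f` when `p ∣ n`.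

The map `T = τ^p` sends `M n` into `M (n + p)`. If `D` and `G` are the matrices of the inclusion and
of `T` between these lattices, then `det (X D - G) = det D · χ(L)`. The crux is that this polynomial
is primitive (`isPrimitive_det_pencil`), so that nothing cancels and `det D` is the denominator over
`F[x]`. Primitivity uses that an element of the union of the `M m` which `T` sends into `M (n + p)`
already lies in `M n` (`mem_of_iterate_mem`), another consequence of stability.

Finally, `χ(L)` and the norm are invariant under the shift (`charpoly_iterate_map`,
`shiftNorm_comp`), and the invariants of `F[x]` are `F[x^p - x]`
(`exists_comp_eq_of_comp_X_add_one`), so the identity descends to `F[Z]`, where primitivity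
persists. -/

namespace ShiftOperator

open Polynomial

/-! ### Matrix pencils of a linear map between two lattices -/

section Pencil

variable {R ι : Type*} [CommRing R]

/-- The pencil `X D - G` attached to two square matrices. -/
noncomputable def pencil (D G : Matrix ι ι R) : Matrix ι ι R[X] :=
  (X : R[X]) • D.map C - G.map C

theorem map_pencil {S : Type*} [CommRing S] (f : R →+* S) (D G : Matrix ι ι R) :
    (pencil D G).map (Polynomial.map f) = pencil (D.map f) (G.map f) := by
  ext i j : 2
  simp [pencil]

variable [Fintype ι]

theorem coeff_pencil_mulVec_zero (D G : Matrix ι ι R) (u : ι → R[X]) (i : ι) :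
    ((pencil D G).mulVec u i).coeff 0 = -∑ j, G i j * (u j).coeff 0 := by
  simp [pencil, Matrix.mulVec, dotProduct, sub_mul, mul_assoc]

theorem coeff_pencil_mulVec_succ (D G : Matrix ι ι R) (u : ι → R[X]) (i : ι) (n : ℕ) :
    ((pencil D G).mulVec u i).coeff (n + 1) =
      ∑ j, D i j * (u j).coeff n - ∑ j, G i j * (u j).coeff (n + 1) := by
  simp [pencil, Matrix.mulVec, dotProduct, sub_mul, mul_assoc, coeff_X_mul]

variable {K V : Type*} [Field K] [Algebra R K] [AddCommGroup V] [Module K V] [Module R V]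
  [IsScalarTower R K V]

theorem map_eq_basis_toMatrix {b : ι → V} {b' : Module.Basis ι K V} {D : Matrix ι ι R}
    (hD : ∀ j, b j = ∑ i, D i j • b' i) : D.map (algebraMap R K) = b'.toMatrix b := by
  classical
  ext i j
  rw [Module.Basis.toMatrix_apply, hD j]
  simp [← algebraMap_smul K, Finsupp.single_apply, mul_comm]

variable [DecidableEq ι]

/-- Over `K` the matrix `D` is a change of basis and `G = D [T]_b`, so the pencil factors as `D`
times the characteristic matrix of `[T]_b`. -/
theorem map_det_pencil (T : V →ₗ[K] V) (b b' : Module.Basis ι K V) (D G : Matrix ι ι R)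
    (hD : ∀ j, b j = ∑ i, D i j • b' i) (hG : ∀ j, T (b j) = ∑ i, G i j • b' i) :
    haveI := Module.Finite.of_basis b
    (pencil D G).det.map (algebraMap R K) = C (algebraMap R K D.det) * T.charpoly := by
  have := Module.Finite.of_basis b
  have hD' := map_eq_basis_toMatrix (K := K) hD
  have hG' : G.map (algebraMap R K) = LinearMap.toMatrix b b' T := by
    ext i j
    rw [LinearMap.toMatrix_apply, hG j]
    simp [← algebraMap_smul K, Finsupp.single_apply, mul_comm]
  have hmul : pencil (D.map (algebraMap R K)) (G.map (algebraMap R K)) =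
      (D.map (algebraMap R K)).map C * (LinearMap.toMatrix b b T).charmatrix := by
    rw [hG', ← basis_toMatrix_mul_linearMap_toMatrix b b' b T, ← hD', Matrix.charmatrix, mul_sub,
      pencil]
    congr 1
    · rw [Matrix.scalar_apply, ← Matrix.smul_one_eq_diagonal, Matrix.mul_smul, mul_one]
    · simp [Matrix.map_mul, RingHom.mapMatrix_apply]
  rw [← coe_mapRingHom, RingHom.map_det, RingHom.mapMatrix_apply, coe_mapRingHom, map_pencil, hmul,
    Matrix.det_mul, ← LinearMap.charpoly_toMatrix T b, Matrix.charpoly, RingHom.map_det,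
    RingHom.mapMatrix_apply, RingHom.map_det, RingHom.mapMatrix_apply]

/-- If a prime `q` divides the determinant, the pencil modulo `q` kills a nonzero polynomial vector.
Dividing a lift of its coefficients by `q` gives `w n`, finitely many nonzero, with `T (w 0)` and
every `w n - T (w (n + 1))` in the larger lattice. Descending from `w n = 0` puts all `w n` in `U`;
ascending from `w 0` with `hinj` puts them in the smaller lattice. So `q` divides the whole lift, a
contradiction. -/
theorem isPrimitive_det_pencil [IsDomain R] [IsPrincipalIdealRing R] [IsFractionRing R K]
    (T : V →ₗ[K] V) (b b' : Module.Basis ι K V) (D G : Matrix ι ι R)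
    (hD : ∀ j, b j = ∑ i, D i j • b' i) (hG : ∀ j, T (b j) = ∑ i, G i j • b' i)
    (U : Submodule R V) (hU : ∀ v ∈ U, T v ∈ U)
    (hbU : Submodule.span R (Set.range b') ≤ U)
    (hinj : ∀ v ∈ U, T v ∈ Submodule.span R (Set.range b') →
      v ∈ Submodule.span R (Set.range b)) :
    (pencil D G).det.IsPrimitive := by
  intro r hr
  by_contra hru
  have hr0 : r ≠ 0 := by
    rintro rfl
    have hdet : (pencil D G).det = 0 := by simpa using hr
    have h := map_det_pencil T b b' D G hD hG
    have hunit : algebraMap R K D.det ≠ 0 := by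
      rw [RingHom.map_det, RingHom.mapMatrix_apply, map_eq_basis_toMatrix (K := K) hD, ← Module.Basis.det_apply]
      exact (b'.isUnit_det b).ne_zero
    rw [hdet, Polynomial.map_zero, eq_comm, mul_eq_zero, C_eq_zero] at h
    have := Module.Finite.of_basis b
    exact h.elim hunit (LinearMap.charpoly_monic T).ne_zero
  obtain ⟨q, hq, hqr⟩ := WfDvdMonoid.exists_irreducible_factor hru hr0
  have hprime : Prime q := hq.prime
  let k := R ⧸ Ideal.span {q}
  have : (Ideal.span {q}).IsPrime := (Ideal.span_singleton_prime hq.ne_zero).2 hprime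
  let f : R →+* k := Ideal.Quotient.mk _
  have hf0 : ∀ a, f a = 0 ↔ q ∣ a := fun a => by
    rw [Ideal.Quotient.eq_zero_iff_mem, Ideal.mem_span_singleton]
  have hdet : (pencil (D.map f) (G.map f)).det = 0 := by
    rw [← map_pencil, ← coe_mapRingHom, ← RingHom.mapMatrix_apply, ← RingHom.map_det, coe_mapRingHom]
    obtain ⟨s, hs⟩ := ((C_dvd_iff_dvd_coeff _ _).2 fun n =>
      hqr.trans ((C_dvd_iff_dvd_coeff _ _).1 hr n) : C q ∣ (pencil D G).det)
    rw [hs, Polynomial.map_mul, map_C, (hf0 q).2 dvd_rfl, C_0, zero_mul]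
  -- A singular square matrix over the domain `k[X]` has a nonzero kernel vector with entries in
  -- `k[X]`.
  obtain ⟨u', hu'0, hu'⟩ := Matrix.exists_mulVec_eq_zero_iff.2 hdet
  choose u hu using fun j => Polynomial.map_surjective f Ideal.Quotient.mk_surjective (u' j)
  have hdvd : ∀ i n, q ∣ ((pencil D G).mulVec u i).coeff n := by
    intro i n
    rw [← hf0, ← coeff_map, ← coe_mapRingHom, RingHom.map_mulVec, coe_mapRingHom, map_pencil]
    have : (Polynomial.map f ∘ u) = u' := funext hu
    rw [this, hu']
    simp
  choose m hm using hdvd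
  have hqK : algebraMap R K q ≠ 0 := by simpa using hq.ne_zero
  let y : ℕ → V := fun n => ∑ j, (u j).coeff n • b j
  let w : ℕ → V := fun n => (algebraMap R K q)⁻¹ • y n
  have hw : ∀ n, q • w n = y n := fun n => by
    rw [← algebraMap_smul K, smul_smul, mul_inv_cancel₀ hqK, one_smul]
  have hcancel : ∀ {x z : V}, q • x = q • z → x = z := by
    intro x z h
    rw [← algebraMap_smul K, ← algebraMap_smul K q z] at h
    exact smul_right_injective V hqK h
  have hyD : ∀ n, y n = ∑ i, (∑ j, D i j * (u j).coeff n) • b' i := fun n => by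
    simp only [y, hD, Finset.smul_sum, Finset.sum_smul, smul_smul]
    rw [Finset.sum_comm]
    simp only [mul_comm]
  have hTR : ∀ (a : R) (v : V), T (a • v) = a • T v := fun a v => by
    rw [← algebraMap_smul K, map_smul, algebraMap_smul]
  have hyG : ∀ n, T (y n) = ∑ i, (∑ j, G i j * (u j).coeff n) • b' i := fun n => by
    simp only [y, map_sum, hTR, hG, Finset.smul_sum, Finset.sum_smul, smul_smul]
    rw [Finset.sum_comm]
    simp only [mul_comm]
  have hmem : ∀ c : ι → R, ∑ i, c i • b' i ∈ Submodule.span R (Set.range b') := fun c =>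
    Submodule.sum_mem _ fun i _ => Submodule.smul_mem _ _ (Submodule.subset_span ⟨i, rfl⟩)
  have h0 : T (w 0) ∈ Submodule.span R (Set.range b') := by
    have : T (w 0) = ∑ i, (-m i 0) • b' i := by
      apply hcancel
      rw [← hTR, hw, hyG, Finset.smul_sum]
      refine Finset.sum_congr rfl fun i _ => ?_
      rw [smul_smul, mul_neg, ← hm, coeff_pencil_mulVec_zero, neg_neg]
    rw [this]
    exact hmem _
  -- The coefficients of `X ^ (n + 1)` in `(X D - G) u = q m`, divided by `q`; the constant
  -- coefficient gave `h0`.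
  have hsucc : ∀ n, w n - T (w (n + 1)) ∈ Submodule.span R (Set.range b') := by
    intro n
    have : w n - T (w (n + 1)) = ∑ i, m i (n + 1) • b' i := by
      apply hcancel
      rw [smul_sub, ← hTR, hw, hw, hyG, hyD, Finset.smul_sum, ← Finset.sum_sub_distrib]
      refine Finset.sum_congr rfl fun i _ => ?_
      rw [smul_smul, ← hm, coeff_pencil_mulVec_succ, sub_smul]
    rw [this]
    exact hmem _
  -- Downward induction: `w n = 0` beyond the degrees of the `u j`, and `U` is stable under `T` and
  -- contains the larger lattice.
  have hwU : ∀ n, w n ∈ U := by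
    let d := Finset.univ.sup fun j => (u j).natDegree + 1
    have hbig : ∀ n, d ≤ n → w n ∈ U := by
      intro n hn
      have : y n = 0 := Finset.sum_eq_zero fun j _ => by
        rw [coeff_eq_zero_of_natDegree_lt, zero_smul]
        have : (u j).natDegree + 1 ≤ d :=
          Finset.le_sup (f := fun j => (u j).natDegree + 1) (Finset.mem_univ j)
        omega
      simp only [w, this, smul_zero, U.zero_mem]
    have hdown : ∀ n, w (n + 1) ∈ U → w n ∈ U := fun n h => by
      have := U.add_mem (hbU (hsucc n)) (hU _ h)
      rwa [sub_add_cancel] at this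
    intro n
    exact Nat.decreasingInduction' (P := fun k => w k ∈ U) (fun k _ _ h => hdown k h)
      (le_max_left n d) (hbig _ (le_max_right n d))
  have hbb' : Submodule.span R (Set.range b) ≤ Submodule.span R (Set.range b') := by
    rw [Submodule.span_le]
    rintro _ ⟨j, rfl⟩
    rw [hD j]
    exact hmem _
  -- Upward induction: once `w n` lies in the smaller lattice, `T (w (n + 1))` lies in the larger
  -- one and `hinj` applies.
  have hwN : ∀ n, w n ∈ Submodule.span R (Set.range b) := by
    intro n
    induction n with
    | zero => exact hinj _ (hwU 0) h0
    | succ n ih =>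
      refine hinj _ (hwU _) ?_
      have := Submodule.sub_mem _ (hbb' ih) (hsucc n)
      rwa [sub_sub_cancel] at this
  have hbR : LinearIndependent R b := (LinearIndependent.iff_fractionRing R K).2 b.linearIndependent
  apply hu'0
  ext j n
  rw [← hu j, coeff_map, Pi.zero_apply, coeff_zero, hf0]
  obtain ⟨c, hc⟩ := (Submodule.mem_span_range_iff_exists_fun R).1 (hwN n)
  have : ∑ j, ((u j).coeff n - q * c j) • b j = 0 := by
    simp only [sub_smul, Finset.sum_sub_distrib, mul_smul, ← Finset.smul_sum, hc, hw]
    simp [y]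
  exact ⟨c j, sub_eq_zero.1 (Fintype.linearIndependent_iff.1 hbR _ this j)⟩

end Pencil

/-! ### Determinants of lattice inclusions -/

section Index

open Module Submodule

/-- When `w` generates the direct sum of the `R / a i`, cyclicity forces the `a i` to be pairwise
coprime. Their product is then their least common multiple, which generates the annihilator of `w`.
-/
theorem associated_prod_of_cyclic {R ι : Type*} [CommRing R] [IsDomain R]
    [IsPrincipalIdealRing R] [Fintype ι] [DecidableEq ι] (a w : ι → R) (φ : R)
    (hgen : ∀ j, ∃ s, ∀ i, a i ∣ (if i = j then 1 else 0) - s * w i)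
    (hφ : ∀ t, (∀ i, a i ∣ t * w i) ↔ φ ∣ t) : Associated (∏ i, a i) φ := by
  have hw : ∀ i, IsCoprime (a i) (w i) := fun i => by
    obtain ⟨s, hs⟩ := hgen i
    obtain ⟨r, hr⟩ := hs i
    exact ⟨r, s, by rw [if_pos rfl] at hr; linear_combination -hr⟩
  have hco : ∀ i j, i ≠ j → IsCoprime (a i) (a j) := fun i j hij => by
    obtain ⟨s, hs⟩ := hgen j
    obtain ⟨r, hr⟩ := hs j
    have hi := hs i
    rw [if_neg hij, zero_sub, dvd_neg] at hi
    obtain ⟨c, hc⟩ := (hw i).dvd_of_dvd_mul_right hi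
    exact ⟨c * w j, r, by rw [if_pos rfl] at hr; linear_combination -hr - w j * hc⟩
  refine associated_of_dvd_dvd ?_ ?_
  · refine Finset.prod_dvd_of_coprime (fun i _ j _ hij => hco i j hij) fun i _ => ?_
    exact (hw i).dvd_of_dvd_mul_right ((hφ φ).2 dvd_rfl i)
  · exact (hφ _).1 fun i => (Finset.dvd_prod_of_mem a (Finset.mem_univ i)).mul_right _

variable {R V : Type*} (K : Type*) [CommRing R] [Field K] [Algebra R K]
  [AddCommGroup V] [Module K V] [Module R V]

/-- The inclusion of lattices `N ⊆ N'` has determinant `d`, up to a unit. -/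
def HasIndex (N N' : Submodule R V) (d : R) : Prop :=
  ∃ (b b' : Basis (Fin (finrank K V)) K V)
    (D : Matrix (Fin (finrank K V)) (Fin (finrank K V)) R),
    span R (Set.range b) = N ∧ span R (Set.range b') = N' ∧
      (∀ j, b j = ∑ i, D i j • b' i) ∧ Associated D.det d

variable {K}

theorem exists_matrix_of_span_le {ι : Type*} [Fintype ι] {b b' : ι → V}
    (h : span R (Set.range b) ≤ span R (Set.range b')) :
    ∃ D : Matrix ι ι R, ∀ j, b j = ∑ i, D i j • b' i := by
  choose D hD using fun j => (mem_span_range_iff_exists_fun R).1 (h (subset_span ⟨j, rfl⟩))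
  exact ⟨fun i j => D j i, fun j => (hD j).symm⟩

theorem eq_sum_mul {ι : Type*} [Fintype ι] {b b' c : ι → V} {D E : Matrix ι ι R}
    (hD : ∀ j, b j = ∑ i, D i j • b' i) (hE : ∀ j, b' j = ∑ i, E i j • c i) (j : ι) :
    b j = ∑ i, (E * D) i j • c i := by
  simp only [hD j, hE, Matrix.mul_apply, Finset.smul_sum, Finset.sum_smul, smul_smul]
  rw [Finset.sum_comm]
  simp only [mul_comm]

variable [IsFractionRing R K] [IsScalarTower R K V]

theorem isUnit_det_of_span_eq {ι : Type*} [Fintype ι] [DecidableEq ι] {b b' : Basis ι K V}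
    {P : Matrix ι ι R} (h : span R (Set.range b) = span R (Set.range b'))
    (hP : ∀ j, b j = ∑ i, P i j • b' i) : IsUnit P.det := by
  obtain ⟨Q, hQ⟩ := exists_matrix_of_span_le h.ge
  have h1 : (P * Q).map (algebraMap R K) = (1 : Matrix ι ι R).map (algebraMap R K) := by
    rw [Matrix.map_mul, map_eq_basis_toMatrix (K := K) hP, map_eq_basis_toMatrix (K := K) hQ,
      Basis.toMatrix_mul_toMatrix_flip, Matrix.map_one _ (map_zero _) (map_one _)]
  have h2 : P * Q = 1 := Matrix.map_injective (IsFractionRing.injective R K) h1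
  exact IsUnit.of_mul_eq_one Q.det (by rw [← Matrix.det_mul, h2, Matrix.det_one])

/-- The two bases given for the middle lattice differ by a matrix `P` of unit determinant. -/
theorem HasIndex.trans {N N' N'' : Submodule R V} {d e : R} (h : HasIndex K N N' d)
    (h' : HasIndex K N' N'' e) : HasIndex K N N'' (d * e) := by
  obtain ⟨b, b', D, hb, hb', hD, hd⟩ := h
  obtain ⟨c', c, E, hc', hc, hE, he⟩ := h'
  obtain ⟨P, hP⟩ := exists_matrix_of_span_le (hb'.trans hc'.symm).le
  refine ⟨b, c, E * (P * D), hb, hc, eq_sum_mul (eq_sum_mul hD hP) hE, ?_⟩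
  rw [Matrix.det_mul, Matrix.det_mul, mul_comm]
  have hu := isUnit_det_of_span_eq (hb'.trans hc'.symm) hP
  refine Associated.mul_mul ?_ he
  rw [mul_comm]
  exact (associated_mul_unit_left _ _ hu).trans hd

theorem span_extendOfIsLattice {ι : Type*} {N : Submodule R V} [IsLattice K N] (b : Basis ι R N) :
    span R (Set.range (b.extendOfIsLattice K)) = N := by
  have : Set.range (b.extendOfIsLattice K) = N.subtype '' Set.range b := by
    rw [← Set.range_comp]
    exact congrArg Set.range (funext fun i => Basis.extendOfIsLattice_apply K b i)
  rw [this, ← map_span, b.span_eq, Submodule.map_top, range_subtype]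

variable [IsDomain R] [IsPrincipalIdealRing R]

/-- Smith normal form makes the inclusion diagonal with entries `a i`; the quotient is generated by
`w` with annihilator `φ`, so `associated_prod_of_cyclic` identifies the determinant. -/
theorem hasIndex_of_cyclic {N : Submodule R V} [IsLattice K N] {w : V} {φ : R}
    (hφ : ∀ t : R, t • w ∈ N ↔ φ ∣ t) : HasIndex K N (N ⊔ span R {w}) φ := by
  set N' := N ⊔ span R {w} with hN'
  have hle : N ≤ N' := le_sup_left
  have hlat : IsLattice K N' :=
    ⟨IsLattice.fg.sup (fg_span_singleton w), by
      rw [eq_top_iff, ← IsLattice.span_eq_top (M := N)]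
      exact span_mono hle⟩
  have hr' : finrank R N' = finrank K V := by
    rw [finrank, finrank, IsLattice.rank' K N']
  have hr : finrank R (N.comap N'.subtype) = finrank R N' := by
    rw [(comapSubtypeEquivOfLe hle).finrank_eq, finrank, finrank, IsLattice.rank' K N,
      IsLattice.rank' K N']
  obtain ⟨b', a, c, hc⟩ := (N.comap N'.subtype).exists_smith_normal_form_of_rank_eq
    ((finBasis R N').reindex (finCongr hr')) hr
  let b : Basis (Fin (finrank K V)) R N := c.map (comapSubtypeEquivOfLe hle)
  have hb : ∀ i, (b i : V) = a i • (b' i : V) := fun i => by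
    have := congrArg N'.subtype (hc i)
    simpa [b] using this
  have hmem : ∀ x : N', (x : V) ∈ N ↔ ∀ i, a i ∣ b'.repr x i := by
    intro x
    constructor
    · intro hx i
      have hx' : x = ∑ i, (b.repr ⟨x, hx⟩ i * a i) • b' i := by
        apply Subtype.ext
        have := congrArg N.subtype (b.sum_repr ⟨x, hx⟩)
        simp only [map_sum, map_smul, subtype_apply, hb] at this
        refine this.symm.trans ?_
        simp [smul_smul]
      rw [hx', map_sum, Finsupp.finsetSum_apply]
      simp [Finsupp.single_apply]
    · intro h
      rw [← b'.sum_repr x, ← subtype_apply, map_sum]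
      refine N.sum_mem fun i _ => ?_
      obtain ⟨r, hr⟩ := h i
      rw [hr, mul_comm, mul_smul, map_smul, map_smul, subtype_apply, ← hb]
      exact N.smul_mem _ (b i).2
  refine ⟨b.extendOfIsLattice K, b'.extendOfIsLattice K, Matrix.diagonal a,
    span_extendOfIsLattice b, span_extendOfIsLattice b', fun j => ?_, ?_⟩
  · rw [Finset.sum_eq_single j (fun i _ hij => by rw [Matrix.diagonal_apply_ne _ hij, zero_smul])
      (by simp), Matrix.diagonal_apply_eq, Basis.extendOfIsLattice_apply,
      Basis.extendOfIsLattice_apply, hb]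
  · rw [Matrix.det_diagonal]
    have hw : w ∈ N' := mem_sup_right (mem_span_singleton_self w)
    refine associated_prod_of_cyclic a (b'.repr ⟨w, hw⟩) φ (fun j => ?_) fun t => ?_
    · obtain ⟨y, hy, z, hz, hyz⟩ := mem_sup.1 (b' j).2
      obtain ⟨s, rfl⟩ := mem_span_singleton.1 hz
      refine ⟨s, fun i => ?_⟩
      have := (hmem (b' j - s • ⟨w, hw⟩)).1 (by simpa [← hyz] using hy) i
      rw [map_sub, map_smul, Finsupp.sub_apply, Finsupp.smul_apply, Basis.repr_self,
        Finsupp.single_apply] at this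
      simpa only [eq_comm, smul_eq_mul] using this
    · rw [← hφ]
      have := hmem (t • ⟨w, hw⟩)
      simp only [map_smul, Finsupp.smul_apply, smul_eq_mul] at this
      exact this.symm

theorem HasIndex.refl (N : Submodule R V) [IsLattice K N] : HasIndex K N N 1 := by
  have := hasIndex_of_cyclic (K := K) (N := N) (w := 0) (φ := 1) (by simp)
  simpa using this

end Index

/-! ### The filtration generated by a cyclic vector of a semilinear map -/

section Filtration

open Module Submodule

variable {R K V : Type*} [CommRing R] [AddCommGroup V] [Module R V]

/-- The `R`-span of `v 0, …, v (n - 1)`. -/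
def spanLT (R : Type*) {V : Type*} [CommRing R] [AddCommGroup V] [Module R V] (v : ℕ → V) (n : ℕ) :
    Submodule R V :=
  span R (v '' Set.Iio n)

theorem spanLT_mono (v : ℕ → V) : Monotone (spanLT R v) := fun _ _ h =>
  span_mono (Set.image_mono (Set.Iio_subset_Iio h))

theorem mem_spanLT (v : ℕ → V) {i n : ℕ} (h : i < n) : v i ∈ spanLT R v n :=
  subset_span ⟨i, h, rfl⟩

theorem spanLT_succ (v : ℕ → V) (n : ℕ) : spanLT R v (n + 1) = spanLT R v n ⊔ span R {v n} := by
  rw [spanLT, spanLT, ← span_union, ← Set.image_singleton, ← Set.image_union]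
  congr 2
  ext i
  simp only [Set.mem_Iio, Set.mem_union, Set.mem_singleton_iff]
  omega

theorem exists_mem_spanLT (v : ℕ → V) {x : V} (hx : x ∈ span R (Set.range v)) :
    ∃ n, x ∈ spanLT R v n := by
  induction hx using span_induction with
  | mem x h => obtain ⟨i, rfl⟩ := h; exact ⟨i + 1, mem_spanLT v (Nat.lt_succ_self i)⟩
  | zero => exact ⟨0, zero_mem _⟩
  | add x y _ _ hx hy =>
    obtain ⟨m, hm⟩ := hx
    obtain ⟨n, hn⟩ := hy
    exact ⟨max m n, add_mem (spanLT_mono v (le_max_left m n) hm)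
      (spanLT_mono v (le_max_right m n) hn)⟩
  | smul a x _ hx => obtain ⟨n, hn⟩ := hx; exact ⟨n, smul_mem _ a hn⟩

theorem spanLT_le (v : ℕ → V) (n : ℕ) : spanLT R v n ≤ span R (Set.range v) :=
  span_mono (Set.image_subset_range _ _)

theorem exists_isLattice_spanLT [Field K] [Algebra R K] [Module K V] [IsScalarTower R K V]
    [Module.Finite K V] (v : ℕ → V) (hspan : span K (Set.range v) = ⊤) :
    ∃ n₁, ∀ n, n₁ ≤ n → IsLattice K (spanLT R v n) := by
  obtain ⟨n₁, h⟩ := monotone_stabilizes_iff_noetherian.2 (inferInstance : IsNoetherian K V)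
    ⟨spanLT K v, spanLT_mono v⟩
  refine ⟨n₁, fun n hn => ⟨fg_span ((Set.finite_Iio n).image v), ?_⟩⟩
  rw [spanLT, span_span_of_tower, eq_top_iff, ← hspan, span_le]
  rintro _ ⟨i, rfl⟩
  have h1 : spanLT K v n = spanLT K v (max n (i + 1)) :=
    (h n hn).symm.trans (h _ (hn.trans (le_max_left _ _)))
  change v i ∈ spanLT K v n
  rw [h1]
  exact mem_spanLT v (by omega)

variable {v : ℕ → V} {t : V →+ V} {s : ℕ → R ≃+* R}

theorem map_mem_spanLT (ht : ∀ m a x, t (s m a • x) = s (m + 1) a • t x)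
    (hv : ∀ n, t (v n) = v (n + 1)) {n : ℕ} {x : V} (hx : x ∈ spanLT R v n) :
    t x ∈ spanLT R v (n + 1) := by
  induction hx using span_induction with
  | mem x h =>
    obtain ⟨i, hi, rfl⟩ := h
    rw [hv]
    exact mem_spanLT v (Nat.succ_lt_succ hi)
  | zero => rw [map_zero]; exact zero_mem _
  | add x y _ _ hx hy => rw [map_add]; exact add_mem hx hy
  | smul a x _ hx =>
    -- The rule `ht` treats scalars of the form `s m b`; since `s 0` is onto, every scalar is of
    -- this form.
    obtain ⟨b, rfl⟩ := (s 0).surjective a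
    rw [ht]
    exact smul_mem _ _ hx

theorem iterate_mem_spanLT (ht : ∀ m a x, t (s m a • x) = s (m + 1) a • t x)
    (hv : ∀ n, t (v n) = v (n + 1)) {n : ℕ} (k : ℕ) {x : V} (hx : x ∈ spanLT R v n) :
    t^[k] x ∈ spanLT R v (n + k) := by
  induction k with
  | zero => exact hx
  | succ k ih =>
    rw [Function.iterate_succ_apply']
    exact map_mem_spanLT ht hv ih

/-- Applying `t` turns a relation at level `m` into one at level `m + 1` with the same `a`. So the
ideals of such `a` increase with union `I`, and the Noetherian property makes them stabilise. -/
theorem exists_stable [IsNoetherianRing R] (ht : ∀ m a x, t (s m a • x) = s (m + 1) a • t x)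
    (hv : ∀ n, t (v n) = v (n + 1)) {I : Ideal R}
    (hI : ∀ a, a ∈ I ↔ ∃ m, s m a • v m ∈ spanLT R v m) :
    ∃ n₀, ∀ n, n₀ ≤ n → ∀ a, s n a • v n ∈ spanLT R v n ↔ a ∈ I := by
  let J : ℕ →o Ideal R := ⟨fun m => {
    carrier := {a | s m a • v m ∈ spanLT R v m}
    zero_mem' := by simp
    add_mem' := fun {a b} ha hb => by
      simp only [Set.mem_ofPred_eq, map_add, add_smul]
      exact add_mem ha hb
    smul_mem' := fun c a ha => by
      simp only [Set.mem_ofPred_eq, smul_eq_mul, map_mul, mul_smul]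
      exact smul_mem _ _ ha }, monotone_nat_of_le_succ fun m a ha => by
        have := map_mem_spanLT ht hv (show s m a • v m ∈ spanLT R v m from ha)
        rwa [ht, hv] at this⟩
  obtain ⟨n₀, h⟩ := monotone_stabilizes_iff_noetherian.2 (inferInstance : IsNoetherian R R) J
  refine ⟨n₀, fun n hn a => ⟨fun ha => (hI a).2 ⟨n, ha⟩, fun ha => ?_⟩⟩
  obtain ⟨m, hm⟩ := (hI a).1 ha
  have h1 : a ∈ J (max n m) := J.monotone (le_max_right n m) hm
  rw [← h _ (hn.trans (le_max_left n m)), h n hn] at h1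
  exact h1

/-- From level `n` on, `t` induces injective maps between successive graded pieces: the same ideal
`I` governs when the top term of `x` and that of `t x` drop to a lower level. -/
theorem mem_of_map_mem {I : Ideal R} {n : ℕ}
    (ht : ∀ m a x, t (s m a • x) = s (m + 1) a • t x) (hv : ∀ n, t (v n) = v (n + 1))
    (hst : ∀ m, n ≤ m → ∀ a, s m a • v m ∈ spanLT R v m ↔ a ∈ I) {x : V}
    (hx : x ∈ span R (Set.range v)) (htx : t x ∈ spanLT R v (n + 1)) : x ∈ spanLT R v n := by
  obtain ⟨k, hk⟩ := exists_mem_spanLT v hx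
  induction k with
  | zero => exact spanLT_mono v (Nat.zero_le n) hk
  | succ k ih =>
    rcases lt_or_ge k n with h | h
    · exact spanLT_mono v h hk
    · apply ih
      rw [spanLT_succ, mem_sup] at hk
      obtain ⟨y, hy, z, hz, rfl⟩ := hk
      obtain ⟨a, rfl⟩ := mem_span_singleton.1 hz
      obtain ⟨b, rfl⟩ := (s k).surjective a
      refine add_mem hy ((hst k h b).2 ((hst (k + 1) (by omega) b).1 ?_))
      rw [map_add, ht, hv] at htx
      exact (add_mem_cancel_left (map_mem_spanLT ht hv hy)).1 (spanLT_mono v (by omega) htx)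

theorem mem_of_iterate_mem {I : Ideal R} {n : ℕ}
    (ht : ∀ m a x, t (s m a • x) = s (m + 1) a • t x) (hv : ∀ n, t (v n) = v (n + 1))
    (hst : ∀ m, n ≤ m → ∀ a, s m a • v m ∈ spanLT R v m ↔ a ∈ I) (k : ℕ) {x : V}
    (hx : x ∈ span R (Set.range v)) (htx : t^[k] x ∈ spanLT R v (n + k)) :
    x ∈ spanLT R v n := by
  induction k generalizing n x with
  | zero => exact htx
  | succ k ih =>
    refine mem_of_map_mem ht hv hst hx (ih (fun m hm => hst m (by omega)) ?_ ?_)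
    · obtain ⟨j, hj⟩ := exists_mem_spanLT v hx
      exact spanLT_le v _ (map_mem_spanLT ht hv hj)
    · rwa [Function.iterate_succ_apply, ← add_assoc, add_right_comm] at htx

variable [IsDomain R] [IsPrincipalIdealRing R] [Field K] [Algebra R K] [IsFractionRing R K]
  [Module K V] [IsScalarTower R K V]

theorem hasIndex_spanLT {f : R} {n : ℕ}
    (hst : ∀ m, n ≤ m → ∀ a, s m a • v m ∈ spanLT R v m ↔ f ∣ a)
    (hlat : ∀ m, n ≤ m → IsLattice K (spanLT R v m)) (k : ℕ) :
    HasIndex K (spanLT R v n) (spanLT R v (n + k)) (∏ j ∈ Finset.range k, s (n + j) f) := by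
  induction k with
  | zero =>
    have := hlat n le_rfl
    simpa using HasIndex.refl (K := K) (spanLT R v n)
  | succ k ih =>
    have := hlat (n + k) (by omega)
    rw [Finset.prod_range_succ, ← add_assoc, spanLT_succ]
    refine ih.trans (hasIndex_of_cyclic fun a => ?_)
    obtain ⟨b, rfl⟩ := (s (n + k)).surjective a
    rw [hst _ (by omega), map_dvd_iff]

/-- The characteristic polynomial of the `p`-th iterate `T` of a semilinear map with a cyclic
vector, up to a primitive polynomial. -/
theorem exists_isPrimitive_map_eq [Module.Finite K V] (p : ℕ) {f : R} {T : V →ₗ[K] V}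
    (ht : ∀ m a x, t (s m a • x) = s (m + 1) a • t x) (hv : ∀ n, t (v n) = v (n + 1))
    (hspan : span K (Set.range v) = ⊤) (hT : ∀ x, T x = t^[p] x)
    (hf : ∀ a, f ∣ a ↔ ∃ m, s m a • v m ∈ spanLT R v m) :
    ∃ n₁, ∀ n, n₁ ≤ n → ∃ (g : R[X]) (d : R), g.IsPrimitive ∧
      Associated d (∏ j ∈ Finset.range p, s (n + j) f) ∧
      g.map (algebraMap R K) = C (algebraMap R K d) * T.charpoly := by
  obtain ⟨n₁, hn₁⟩ := exists_isLattice_spanLT (R := R) v hspan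
  obtain ⟨n₀, hn₀⟩ := exists_stable (I := Ideal.span {f}) ht hv
    (fun a => by rw [Ideal.mem_span_singleton, hf])
  refine ⟨max n₀ n₁, fun n hn => ?_⟩
  have hst : ∀ m, n ≤ m → ∀ a, s m a • v m ∈ spanLT R v m ↔ a ∈ Ideal.span {f} :=
    fun m hm => hn₀ m (by omega)
  obtain ⟨b, b', D, hb, hb', hD, hd⟩ := hasIndex_spanLT (K := K)
    (fun m hm a => by rw [hst m hm, Ideal.mem_span_singleton]) (fun m hm => hn₁ m (by omega)) p
  have hU : ∀ x ∈ span R (Set.range v), T x ∈ span R (Set.range v) := fun x hx => by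
    obtain ⟨k, hk⟩ := exists_mem_spanLT v hx
    rw [hT]
    exact spanLT_le v _ (iterate_mem_spanLT ht hv p hk)
  obtain ⟨G, hG⟩ : ∃ G : Matrix _ _ R, ∀ j, T (b j) = ∑ i, G i j • b' i := by
    apply exists_matrix_of_span_le
    rw [span_le, hb']
    rintro _ ⟨j, rfl⟩
    change T (b j) ∈ spanLT R v (n + p)
    rw [hT]
    refine iterate_mem_spanLT ht hv p ?_
    rw [← hb]
    exact subset_span ⟨j, rfl⟩
  refine ⟨(pencil D G).det, D.det, ?_, hd, map_det_pencil T b b' D G hD hG⟩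
  -- `U` is the union of the whole filtration; it is stable under `T` but need not be finitely
  -- generated.
  refine isPrimitive_det_pencil T b b' D G hD hG (span R (Set.range v)) hU ?_ fun x hx hTx => ?_
  · rw [hb']
    exact spanLT_le v _
  · rw [hb', hT] at hTx
    rw [hb]
    exact mem_of_iterate_mem ht hv hst p hx hTx

end Filtration

/-! ### Invariance of the characteristic polynomial of an iterate -/

section Semilinear

open Module

variable {K V ι : Type*} [Field K] [AddCommGroup V] [Module K V] [Fintype ι] [DecidableEq ι]

/-- The matrix `A σ(A) ⋯ σ^(k-1)(A)` of the `k`-th iterate of the semilinear map with matrix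
`A`. -/
def iterateMatrix (σ : K →+* K) (A : Matrix ι ι K) : ℕ → Matrix ι ι K
  | 0 => 1
  | k + 1 => A * (iterateMatrix σ A k).map σ

theorem iterateMatrix_succ' (σ : K →+* K) (A : Matrix ι ι K) (k : ℕ) :
    iterateMatrix σ A (k + 1) = iterateMatrix σ A k * A.map σ^[k] := by
  induction k with
  | zero => simp [iterateMatrix, Matrix.map_one]
  | succ k ih =>
    rw [iterateMatrix]
    conv_lhs => rw [ih]
    rw [Matrix.map_mul, Matrix.map_map, ← mul_assoc, ← iterateMatrix, ← Function.iterate_succ']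

theorem iterate_basis_eq (σ : K →+* K) (b : Basis ι K V) (t : V →+ V)
    (ht : ∀ a x, t (a • x) = σ a • t x) (k : ℕ) (j : ι) :
    t^[k] (b j) = ∑ i, iterateMatrix σ (b.toMatrix fun j => t (b j)) k i j • b i := by
  induction k with
  | zero => simp [iterateMatrix, Matrix.one_apply]
  | succ k ih =>
    rw [Function.iterate_succ_apply', ih, map_sum]
    have h : ∀ i, t (b i) = ∑ l, b.toMatrix (fun j => t (b j)) l i • b l := fun i => by
      simp [Basis.toMatrix_apply, b.sum_repr]
    simp only [ht]
    rw [Finset.sum_congr rfl fun i _ => by rw [h i]]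
    simp only [iterateMatrix, Matrix.mul_apply, Finset.smul_sum, Finset.sum_smul, smul_smul,
      Matrix.map_apply]
    rw [Finset.sum_comm]
    simp only [mul_comm]

/-- The matrix of `T` is `A σ(A) ⋯ σ^(p-1)(A)`. As `σ^p = 1`, applying `σ` moves the first factor to
the end, and `BC` and `CB` have the same characteristic polynomial. -/
theorem charpoly_iterate_map [Module.Finite K V] (σ : K →+* K) (p : ℕ) (hp : p ≠ 0)
    (hσ : ∀ a, σ^[p] a = a) (t : V →+ V) (ht : ∀ a x, t (a • x) = σ a • t x)
    (T : V →ₗ[K] V) (hT : ∀ x, T x = t^[p] x) : T.charpoly.map σ = T.charpoly := by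
  obtain ⟨k, rfl⟩ := Nat.exists_eq_succ_of_ne_zero hp
  let b := finBasis K V
  let A := b.toMatrix fun j => t (b j)
  have hTA : LinearMap.toMatrix b b T = iterateMatrix σ A (k + 1) := by
    ext i j
    rw [LinearMap.toMatrix_apply, hT, iterate_basis_eq σ b t ht]
    simp [Finsupp.single_apply, A]
  have hA : A.map σ^[k + 1] = A := by
    ext i j
    exact hσ _
  rw [← LinearMap.charpoly_toMatrix T b, hTA, ← Matrix.charpoly_map]
  have h1 : σ.mapMatrix (iterateMatrix σ A (k + 1)) = (iterateMatrix σ A k).map σ * A := by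
    rw [RingHom.mapMatrix_apply, iterateMatrix_succ', Matrix.map_mul, Matrix.map_map,
      ← Function.iterate_succ', hA]
  rw [RingHom.mapMatrix_apply] at h1
  rw [h1, Matrix.charpoly_mul_comm, iterateMatrix]

end Semilinear

/-! ### Shift-invariant polynomials are polynomials in `x^p - x` -/

section Invariants

variable {F : Type*} [Field F]

theorem degree_comp_X_add_one_le (f : F[X]) : (f.comp (X + 1)).degree ≤ f.degree := by
  by_cases hf : f = 0
  · simp [hf]
  rw [degree_eq_natDegree hf]
  refine degree_le_of_natDegree_le ?_
  have : (X + 1 : F[X]).natDegree = 1 := natDegree_X_add_C 1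
  rw [natDegree_comp, this, mul_one]

theorem comp_add_natCast_add (f : F[X]) (n j : ℕ) :
    (f.comp (X + C (n : F))).comp (X + C (j : F)) = f.comp (X + C ((n + j : ℕ) : F)) := by
  rw [comp_assoc]
  congr 1
  simp [add_assoc, add_comm]

theorem monic_shiftNorm (p : ℕ) {f : F[X]} (hf : f.Monic) : (shiftNorm p f).Monic :=
  monic_prod_of_monic _ _ fun i _ => hf.comp_X_add_C (i : F)

variable (p : ℕ) [hp : Fact p.Prime]

/-- Divide by the invariant polynomial `x^p - x`. By uniqueness, quotient and remainder are again
invariant; the remainder has degree below `p` and equal values at `0, …, p - 1`, so it is constant.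
Induct on the degree through the quotient. -/
theorem exists_comp_eq_of_comp_X_add_one [CharP F p] {f : F[X]} (hf : f.comp (X + 1) = f) :
    ∃ g : F[X], g.comp (X ^ p - X) = f := by
  have hZ : (X ^ p - X : F[X]).Monic := by
    apply monic_X_pow_sub
    rw [degree_X]
    exact_mod_cast hp.out.one_lt
  have hdeg : (X ^ p - X : F[X]).natDegree = p :=
    FiniteField.X_pow_card_sub_X_natDegree_eq F hp.out.one_lt
  have hcomp : (X ^ p - X : F[X]).comp (X + 1) = X ^ p - X := by
    simp [add_pow_char]
  induction h : f.natDegree using Nat.strong_induction_on generalizing f with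
  | _ n ih =>
    subst h
    obtain ⟨hq, hr⟩ := div_modByMonic_unique (f := f) ((f /ₘ (X ^ p - X)).comp (X + 1))
      ((f %ₘ (X ^ p - X)).comp (X + 1)) hZ ⟨by
        conv_rhs => rw [← hf, ← modByMonic_add_div f (X ^ p - X : F[X]), add_comp, mul_comp, hcomp],
        (degree_comp_X_add_one_le _).trans_lt (degree_modByMonic_lt f hZ)⟩
    set r := f %ₘ (X ^ p - X : F[X]) with hrdef
    have hrC : r = C (r.eval 0) := by
      have hev : ∀ i : ℕ, r.eval (i : F) = r.eval 0 := fun i => by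
        induction i with
        | zero => simp
        | succ i ihi => rw [← ihi]; conv_rhs => rw [hr]
                        simp
      have hinj : Set.InjOn (fun i : ℕ => (i : F)) (Finset.range p) := fun i hi j hj h =>
        CharP.natCast_injOn_Iio F p (by simpa using hi) (by simpa using hj) h
      classical
      rw [← sub_eq_zero]
      refine eq_zero_of_degree_lt_of_eval_finset_eq_zero
        ((Finset.range p).image fun i : ℕ => (i : F)) ?_ ?_
      · rw [Finset.card_image_of_injOn hinj, Finset.card_range]
        refine (degree_sub_le _ _).trans_lt (max_lt ?_ (degree_C_le.trans_lt ?_))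
        · have := degree_modByMonic_lt f hZ
          rwa [degree_eq_natDegree hZ.ne_zero, hdeg] at this
        · exact_mod_cast hp.out.pos
      · intro x hx
        obtain ⟨i, -, rfl⟩ := Finset.mem_image.1 hx
        rw [eval_sub, eval_C, hev, sub_self]
    rcases lt_or_ge f.natDegree p with hlt | hge
    · have hfr : r = f := (modByMonic_eq_self_iff hZ).2 (degree_lt_degree (by rwa [hdeg]))
      exact ⟨C (r.eval 0), by rw [C_comp, ← hrC, hfr]⟩
    · obtain ⟨g, hg⟩ := ih (f /ₘ (X ^ p - X)).natDegree (by
        rw [natDegree_divByMonic _ hZ, hdeg]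
        have := hp.out.pos
        omega) hq.symm rfl
      refine ⟨C (r.eval 0) + X * g, ?_⟩
      rw [add_comp, mul_comp, C_comp, X_comp, hg, ← hrC, modByMonic_add_div]

theorem exists_map_comp_eq [CharP F p] {g : F[X][X]} (hg : g.map (compRingHom (X + 1)) = g) :
    ∃ g₀ : F[X][X], g₀.map (compRingHom (X ^ p - X)) = g := by
  rw [← mem_lifts, lifts_iff_coeff_lifts]
  intro n
  obtain ⟨h, hh⟩ := exists_comp_eq_of_comp_X_add_one p (f := g.coeff n)
    (by conv_rhs => rw [← hg, coeff_map]
        rfl)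
  exact ⟨h, hh⟩

theorem shiftNorm_comp [CharP F p] (f : F[X]) :
    (shiftNorm p f).comp (X + 1) = shiftNorm p f := by
  by_cases hf : f = 0
  · simp [shiftNorm, hf, hp.out.ne_zero]
  have h1 : (shiftNorm p f).comp (X + 1) =
      ∏ i ∈ Finset.range p, f.comp (X + C ((i + 1 : ℕ) : F)) := by
    rw [shiftNorm, prod_comp]
    refine Finset.prod_congr rfl fun i _ => ?_
    rw [← comp_add_natCast_add]
    simp
  -- The product over `0, …, p` is split at its first and at its last factor; both are `f` because
  -- `p = 0` in `F`, and they cancel.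
  have h2 := (Finset.prod_range_succ' (fun i : ℕ => f.comp (X + C (i : F))) p).symm.trans
    (Finset.prod_range_succ (fun i : ℕ => f.comp (X + C (i : F))) p)
  simp only [CharP.cast_eq_zero, Nat.cast_zero, map_zero, add_zero, comp_X] at h2
  rw [h1, shiftNorm]
  exact mul_right_cancel₀ hf h2

end Invariants

/-! ### Monic generators and denominators -/

section Denominator

variable {F : Type*} [Field F]

theorem monicGenerator_eq {I : Ideal F[X]} {c : F[X]} (hc : c.Monic) (h : I = Ideal.span {c}) :
    monicGenerator I = c := by
  have ha : Associated (Submodule.IsPrincipal.generator I) c := by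
    rw [← Ideal.span_singleton_eq_span_singleton, ← h]
    exact Ideal.span_singleton_generator I
  have h0 : Submodule.IsPrincipal.generator I ≠ 0 := ha.symm.ne_zero_iff.1 hc.ne_zero
  refine eq_of_monic_of_associated (monic_mul_leadingCoeff_inv h0) hc ?_
  exact (associated_mul_unit_left _ _
    (isUnit_C.2 (isUnit_iff_ne_zero.2 (inv_ne_zero (leadingCoeff_ne_zero.2 h0))))).trans ha

theorem monicGenerator_monic {I : Ideal F[X]} (hI : I ≠ ⊥) :
    (monicGenerator I).Monic ∧ I = Ideal.span {monicGenerator I} := by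
  have h0 : Submodule.IsPrincipal.generator I ≠ 0 := fun h =>
    hI ((Submodule.IsPrincipal.eq_bot_iff_generator_eq_zero I).2 h)
  refine ⟨monic_mul_leadingCoeff_inv h0, ?_⟩
  conv_lhs => rw [← Ideal.span_singleton_generator I]
  rw [Ideal.span_singleton_eq_span_singleton]
  exact (associated_mul_unit_left _ _
    (isUnit_C.2 (isUnit_iff_ne_zero.2 (inv_ne_zero (leadingCoeff_ne_zero.2 h0))))).symm

theorem dvd_of_C_dvd_C_mul {a c : F[X]} {g : F[X][X]} (hg : g.IsPrimitive)
    (h : C c ∣ C a * g) : c ∣ a := by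
  classical
  let _ : StrongNormalizationMonoid F[X] := UniqueFactorizationMonoid.strongNormalizationMonoid
  let _ : NormalizedGCDMonoid F[X] := UniqueFactorizationMonoid.toNormalizedGCDMonoid F[X]
  have h1 := dvd_content_iff_C_dvd.2 h
  rw [(associated_content_C_mul a g).dvd_iff_dvd_right, hg.content_eq_one, mul_one] at h1
  exact h1

/-- If `a q = r` is integral then `a g = c r`; since `g` has content one, comparing contents gives
`c ∣ a`. -/
theorem denom_eq {c : F[X]} (hc : c.Monic) {g : F[X][X]} (hg : g.IsPrimitive)
    {q : (RatFunc F)[X]}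
    (h : C (algebraMap F[X] (RatFunc F) c) * q = g.map (algebraMap F[X] (RatFunc F))) :
    denom q = c := by
  refine monicGenerator_eq hc (le_antisymm (fun a ha => ?_) ?_)
  · obtain ⟨r, hr⟩ := ha
    have : C a * g = C c * r := by
      apply Polynomial.map_injective _ (IsFractionRing.injective F[X] (RatFunc F))
      rw [Polynomial.map_mul, Polynomial.map_mul, ← h, ← hr, map_C, map_C]
      ring
    rw [Ideal.mem_span_singleton]
    exact dvd_of_C_dvd_C_mul hg (this ▸ dvd_mul_right _ _)
  · rw [Ideal.span_singleton_le_iff_mem]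
    exact ⟨g, h⟩

end Denominator

/-! ### The filtration of the quotient module by powers of `τ` -/

section Quotient

open Module Submodule

variable {F : Type*} [Field F]

noncomputable instance polynomialModule (L : Op F) : Module F[X] (QuotientModule L) :=
  Module.compHom _ (algebraMap F[X] (RatFunc F))

theorem polynomial_smul_def (L : Op F) (a : F[X]) (x : QuotientModule L) :
    a • x = algebraMap F[X] (RatFunc F) a • x := rfl

instance isScalarTower_polynomial (L : Op F) :
    IsScalarTower F[X] (RatFunc F) (QuotientModule L) :=
  ⟨fun a b x => by rw [polynomial_smul_def, Algebra.smul_def, mul_smul]⟩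

/-- The class of `τ ^ i`. -/
noncomputable def powClass (L : Op F) (i : ℕ) : QuotientModule L :=
  Submodule.Quotient.mk (tau F ^ i)

/-- The action of `τ`. -/
noncomputable def tauAction (L : Op F) : QuotientModule L →+ QuotientModule L :=
  DistribSMul.toAddMonoidHom _ (tau F)

theorem tauAction_apply (L : Op F) (x : QuotientModule L) : tauAction L x = tau F • x := rfl

theorem tauAction_powClass (L : Op F) (i : ℕ) :
    tauAction L (powClass L i) = powClass L (i + 1) := by
  rw [tauAction_apply, powClass, powClass, ← Submodule.Quotient.mk_smul, smul_eq_mul, pow_succ']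

theorem smul_eq_C_smul (L : Op F) (f : RatFunc F) (x : QuotientModule L) :
    f • x = (SkewPolynomial.C f : Op F) • x := by
  rw [← mul_one (SkewPolynomial.C f : Op F), ← smul_eq_C_mul', smul_assoc, one_smul]

theorem tauAction_smul (L : Op F) (f : RatFunc F) (x : QuotientModule L) :
    tauAction L (f • x) = shift F f • tauAction L x := by
  rw [tauAction_apply, tauAction_apply, smul_eq_C_smul, smul_eq_C_smul, smul_smul, smul_smul,
    tau_mul_C]

theorem iterate_tauAction (L : Op F) (k : ℕ) (x : QuotientModule L) :
    (tauAction L)^[k] x = tau F ^ k • x :=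
  congrFun (smul_iterate (tau F) k) x

/-- The automorphism `f(x) ↦ f(x + m)` of `F[x]`. -/
noncomputable def polyShift (F : Type*) [Field F] (m : ℕ) : F[X] ≃+* F[X] :=
  (taylorEquiv (m : F)).toRingEquiv

theorem polyShift_apply (m : ℕ) (f : F[X]) : polyShift F m f = f.comp (X + C (m : F)) := rfl

theorem algebraMap_polyShift (m : ℕ) (f : F[X]) :
    algebraMap F[X] (RatFunc F) (polyShift F m f) =
      (shift F ^ m) (algebraMap F[X] (RatFunc F) f) := by
  rw [shift_pow_algebraMap, polyShift_apply]

theorem tauAction_polyShift_smul (L : Op F) (m : ℕ) (a : F[X]) (x : QuotientModule L) :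
    tauAction L (polyShift F m a • x) = polyShift F (m + 1) a • tauAction L x := by
  rw [polynomial_smul_def, tauAction_smul, polynomial_smul_def, algebraMap_polyShift,
    algebraMap_polyShift, pow_succ', AlgEquiv.mul_apply]

theorem eq_sum_coeff_smul_tau_pow {B : Op F} {m : ℕ} (h : ∀ i, m ≤ i → B.coeff i = 0) :
    B = ∑ i ∈ Finset.range m, B.coeff i • tau F ^ i := by
  have hsum : ∀ (s : Finset ℕ) (j : ℕ), (∑ i ∈ s, B.coeff i • tau F ^ i : Op F).coeff j =
      ∑ i ∈ s, if i = j then B.coeff i else 0 := by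
    intro s j
    induction s using Finset.induction_on with
    | empty => simp
    | insert a s ha ihs =>
      rw [Finset.sum_insert ha, Finset.sum_insert ha, SkewPolynomial.coeff_add, ihs,
        tau_pow, SkewPolynomial.smul_monomial, SkewPolynomial.coeff_monomial, smul_eq_mul, mul_one]
  ext j
  rw [hsum, Finset.sum_ite_eq']
  split_ifs with hj
  · rfl
  · exact h j (by simpa using hj)

theorem mk_eq_sum {L B : Op F} {m : ℕ} (h : ∀ i, m ≤ i → B.coeff i = 0) :
    (Submodule.Quotient.mk B : QuotientModule L) =
      ∑ i ∈ Finset.range m, B.coeff i • powClass L i := by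
  conv_lhs => rw [eq_sum_coeff_smul_tau_pow h]
  rw [← mkQ_apply, map_sum]
  rfl

theorem span_powClass (L : Op F) : span (RatFunc F) (Set.range (powClass L)) = ⊤ := by
  rw [eq_top_iff]
  rintro x -
  obtain ⟨B, rfl⟩ := mkQ_surjective _ x
  rw [mkQ_apply, mk_eq_sum (m := ord B + 1) fun i hi => coeff_eq_zero_of_ord_lt hi]
  exact sum_mem fun i _ => smul_mem _ _ (subset_span ⟨i, rfl⟩)

theorem exists_isPoly_of_mem_spanLT {L : Op F} {m : ℕ} {x : QuotientModule L}
    (hx : x ∈ spanLT F[X] (powClass L) m) :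
    ∃ B : Op F, IsPoly B ∧ (∀ i, m ≤ i → B.coeff i = 0) ∧ Submodule.Quotient.mk B = x := by
  induction hx using span_induction with
  | mem x h =>
    obtain ⟨i, hi, rfl⟩ := h
    refine ⟨tau F ^ i, fun j => ⟨if i = j then 1 else 0, ?_⟩, fun j hj => ?_, rfl⟩
    · rw [tau_pow, SkewPolynomial.coeff_monomial]
      split_ifs <;> simp
    · rw [tau_pow, SkewPolynomial.coeff_monomial, if_neg]
      have : i < m := hi
      omega
  | zero => exact ⟨0, fun i => ⟨0, by simp⟩, by simp, rfl⟩
  | add x y _ _ hx hy =>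
    obtain ⟨A, hA, hA', rfl⟩ := hx
    obtain ⟨B, hB, hB', rfl⟩ := hy
    refine ⟨A + B, fun i => ?_, fun i hi => by simp [hA' i hi, hB' i hi], rfl⟩
    obtain ⟨f, hf⟩ := hA i
    obtain ⟨g, hg⟩ := hB i
    exact ⟨f + g, by rw [map_add, hf, hg, SkewPolynomial.coeff_add]⟩
  | smul a x _ hx =>
    obtain ⟨A, hA, hA', rfl⟩ := hx
    refine ⟨algebraMap F[X] (RatFunc F) a • A, fun i => ?_, fun i hi => ?_, rfl⟩
    · obtain ⟨f, hf⟩ := hA i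
      exact ⟨a * f, by rw [map_mul, hf, smul_eq_C_mul', coeff_C_mul']⟩
    · rw [smul_eq_C_mul', coeff_C_mul', hA' i hi, mul_zero]

/-- Reducing `A L` modulo `L` expresses its top term through lower powers of `τ`; conversely, such a
relation is an element of the left ideal of `L`. The shift by `m` undoes the normalisation in `lc`.
-/
theorem mem_lcIdeal_iff (L : Op F) (a : F[X]) :
    a ∈ lcIdeal L ↔ ∃ m, polyShift F m a • powClass L m ∈ spanLT F[X] (powClass L) m := by
  refine (isMultipleLC_iff L a).trans ⟨?_, ?_⟩
  · rintro ⟨A, m, hA, hm, h⟩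
    refine ⟨m, ?_⟩
    have h0 : (Submodule.Quotient.mk (A * L) : QuotientModule L) = 0 :=
      (Submodule.Quotient.mk_eq_zero _).2 (smul_mem _ A (mem_span_singleton_self L))
    rw [mk_eq_sum (m := m + 1) fun i hi => hm i hi, Finset.sum_range_succ, h,
      ← algebraMap_polyShift] at h0
    rw [polynomial_smul_def, eq_neg_of_add_eq_zero_right h0]
    refine neg_mem (sum_mem fun i hi => ?_)
    obtain ⟨f, hf⟩ := hA i
    rw [← hf, ← polynomial_smul_def]
    exact smul_mem _ _ (mem_spanLT _ (Finset.mem_range.1 hi))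
  · rintro ⟨m, hm⟩
    obtain ⟨B, hB, hB', hx⟩ := exists_isPoly_of_mem_spanLT hm
    have hmem : algebraMap F[X] (RatFunc F) (polyShift F m a) • tau F ^ m - B ∈
        span (Op F) {L} := by
      rw [← Submodule.Quotient.mk_eq_zero, Submodule.Quotient.mk_sub, hx, sub_eq_zero]
      rfl
    obtain ⟨A, hA⟩ := mem_span_singleton.1 hmem
    have hcoeff : ∀ i, (A * L).coeff i =
        (if m = i then algebraMap F[X] (RatFunc F) (polyShift F m a) else 0) - B.coeff i := by
      intro i
      rw [← smul_eq_mul, hA, SkewPolynomial.coeff_sub, tau_pow, SkewPolynomial.smul_monomial,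
        SkewPolynomial.coeff_monomial, smul_eq_mul, mul_one]
    refine ⟨A, m, fun i => ?_, fun i hi => ?_, ?_⟩
    · obtain ⟨f, hf⟩ := hB i
      refine ⟨(if m = i then polyShift F m a else 0) - f, ?_⟩
      rw [hcoeff, map_sub, hf]
      split_ifs <;> simp
    · rw [hcoeff, if_neg (by omega), hB' i (by omega), sub_zero]
    · rw [hcoeff, if_pos rfl, hB' m le_rfl, sub_zero, algebraMap_polyShift]

/-- The leading coefficient of `L` itself is a nonzero element; this is where polynomial
coefficients of `L` are needed. -/
theorem lcIdeal_ne_bot {L : Op F} (hL : L ≠ 0) (hpoly : IsPoly L) : lcIdeal L ≠ ⊥ := by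
  obtain ⟨c, hc⟩ := hpoly (ord L)
  obtain ⟨a, rfl⟩ := (polyShift F (ord L)).surjective c
  have ha : a ∈ lcIdeal L := (isMultipleLC_iff L a).2
    ⟨1, ord L, by rwa [one_mul], fun i hi => by rw [one_mul, coeff_eq_zero_of_ord_lt hi],
      by rw [one_mul, ← hc, algebraMap_polyShift]⟩
  intro h
  rw [h, Ideal.mem_bot] at ha
  apply coeff_ord_ne_zero hL
  rw [← hc, ha, map_zero, map_zero]

theorem exists_isPrimitive_map_eq_chi (p : ℕ) [hp : Fact p.Prime] [CharP F p] {L : Op F}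
    (hL : L ≠ 0) (hpoly : IsPoly L) :
    ∃ g : F[X][X], g.IsPrimitive ∧ g.map (algebraMap F[X] (RatFunc F)) =
      C (algebraMap F[X] (RatFunc F) (shiftNorm p (essentialLC L))) * chi p L hL := by
  have := finite_quotientModule hL
  obtain ⟨-, hspan⟩ := monicGenerator_monic (lcIdeal_ne_bot hL hpoly)
  obtain ⟨n₁, h⟩ := exists_isPrimitive_map_eq (K := RatFunc F) (s := polyShift F)
    (v := powClass L) (f := essentialLC L) (T := pCurvature p (QuotientModule L)) p
    (tauAction_polyShift_smul L) (tauAction_powClass L) (span_powClass L)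
    (fun x => (iterate_tauAction L p x).symm)
    (fun a => by rw [← mem_lcIdeal_iff, hspan, Ideal.mem_span_singleton, essentialLC])
  -- A level divisible by `p` is chosen so that the shift by `p * n₁` is trivial in characteristic
  -- `p` and the determinant is the norm itself.
  obtain ⟨g, d, hg, hd, hgd⟩ := h (p * n₁) (Nat.le_mul_of_pos_left _ hp.out.pos)
  have hN : ∏ j ∈ Finset.range p, polyShift F (p * n₁ + j) (essentialLC L) =
      shiftNorm p (essentialLC L) :=
    Finset.prod_congr rfl fun j _ => by simp [polyShift_apply]
  rw [hN] at hd
  obtain ⟨u, hu⟩ := hd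
  refine ⟨C (u : F[X]) * g, fun r hr => hg r ?_, ?_⟩
  · exact (IsUnit.dvd_mul_left (isUnit_C.2 u.isUnit)).1 hr
  · rw [Polynomial.map_mul, hgd, map_C, ← hu, map_mul, map_mul]
    rw [chi]
    ring

theorem chi_map_shift (p : ℕ) [hp : Fact p.Prime] [CharP F p] {L : Op F} (hL : L ≠ 0) :
    (chi p L hL).map (shift F : RatFunc F →+* RatFunc F) = chi p L hL := by
  have := finite_quotientModule hL
  refine charpoly_iterate_map _ p hp.out.ne_zero (fun a => ?_) (tauAction L) (tauAction_smul L) _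
    fun x => (iterate_tauAction L p x).symm
  have h := congrArg (fun e : RatFunc F ≃ₐ[F] RatFunc F => e a) (shift_pow_char (F := F) p)
  rw [AlgEquiv.one_apply, AlgEquiv.coe_pow] at h
  exact h

theorem embedZ_algebraMap (p : ℕ) [Fact p.Prime] (f : F[X]) :
    embedZ F p (algebraMap F[X] (RatFunc F) f) =
      algebraMap F[X] (RatFunc F) (f.comp (X ^ p - X)) := by
  have := RatFunc.map_apply_div (compRingHom (X ^ p - X : F[X]))
    (nonZeroDivisors_le_comap_nonZeroDivisors_of_injective _ (comp_injective p)) f 1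
  simpa [embedZ, RatFunc.coe_mapRingHom_eq_coe_map] using this

end Quotient

end ShiftOperator

/-! ### Descent from `F[x]` to `F[Z]` -/

open Polynomial in
theorem mainTheorem1 {F : Type*} [Field F] (p : ℕ) [Fact p.Prime] [CharP F p]
    (L : ShiftOperator.Op F) (hL : L ≠ 0) (hpoly : ShiftOperator.IsPoly L) :
    ∃ χ : (RatFunc F)[X],
      χ.map (ShiftOperator.embedZ F p) = ShiftOperator.chi p L hL ∧
      (ShiftOperator.denom χ).comp (X ^ p - X) =
        ShiftOperator.shiftNorm p (ShiftOperator.essentialLC L) := by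
  open ShiftOperator in
  set N := shiftNorm p (essentialLC L) with hN
  have hNm : N.Monic := monic_shiftNorm p
    (monicGenerator_monic (lcIdeal_ne_bot hL hpoly)).1
  obtain ⟨g, hg, hgN⟩ := exists_isPrimitive_map_eq_chi p hL hpoly
  -- `g` is the norm times the characteristic polynomial, both shift-invariant.
  have hginv : g.map (compRingHom (X + 1)) = g := by
    apply Polynomial.map_injective _ (IsFractionRing.injective F[X] (RatFunc F))
    have hcomm : (algebraMap F[X] (RatFunc F)).comp (compRingHom (X + 1)) =
        (shift F : RatFunc F →+* RatFunc F).comp (algebraMap F[X] (RatFunc F)) :=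
      RingHom.ext fun f => (shift_algebraMap f).symm
    rw [Polynomial.map_map, hcomm, ← Polynomial.map_map, hgN, Polynomial.map_mul, chi_map_shift,
      map_C]
    congr 2
    exact (shift_algebraMap N).trans (congrArg _ (shiftNorm_comp p _))
  obtain ⟨c, hc⟩ := exists_comp_eq_of_comp_X_add_one p (shiftNorm_comp p (essentialLC L))
  obtain ⟨g₀, rfl⟩ := exists_map_comp_eq p hginv
  have hZ : (X ^ p - X : F[X]).Monic := monic_X_pow_sub (by
    rw [degree_X]
    exact_mod_cast (Fact.out : p.Prime).one_lt)
  have hZdeg : (X ^ p - X : F[X]).natDegree = p :=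
    FiniteField.X_pow_card_sub_X_natDegree_eq F (Fact.out : p.Prime).one_lt
  have hcm : c.Monic := by
    have h := leadingCoeff_comp (p := c) (q := X ^ p - X)
      (by rw [hZdeg]; exact (Fact.out : p.Prime).ne_zero)
    rw [hc, ← hN, hNm.leadingCoeff, hZ.leadingCoeff, one_pow, mul_one] at h
    exact h.symm
  -- A constant factor `r` of `g₀` gives the factor `r(x^p - x)` of `g`, which must be a unit; its
  -- degree is `p` times that of `r`, so `r` is itself a nonzero constant.
  have hg₀ : g₀.IsPrimitive := fun r hr => by
    obtain ⟨s, rfl⟩ := hr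
    have h := hg (compRingHom (X ^ p - X) r)
      ⟨s.map (compRingHom (X ^ p - X)), by rw [Polynomial.map_mul, map_C]⟩
    have h0 := natDegree_eq_zero_of_isUnit h
    rw [coe_compRingHom_apply, natDegree_comp, hZdeg, mul_eq_zero_iff_right (Fact.out : p.Prime).ne_zero] at h0
    rw [eq_C_of_natDegree_eq_zero h0] at h ⊢
    simpa using h
  have hc0 : algebraMap F[X] (RatFunc F) c ≠ 0 := by simpa using hcm.ne_zero
  refine ⟨C (algebraMap F[X] (RatFunc F) c)⁻¹ * g₀.map (algebraMap F[X] (RatFunc F)), ?_, ?_⟩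
  · have hcomm : (embedZ F p).comp (algebraMap F[X] (RatFunc F)) =
        (algebraMap F[X] (RatFunc F)).comp (compRingHom (X ^ p - X)) :=
      RingHom.ext fun f => embedZ_algebraMap p f
    have hN0 : algebraMap F[X] (RatFunc F) N ≠ 0 := by simpa using hNm.ne_zero
    rw [Polynomial.map_mul, map_C, Polynomial.map_map, hcomm, ← Polynomial.map_map, hgN, map_inv₀,
      embedZ_algebraMap, hc, ← hN, ← mul_assoc, ← C_mul, inv_mul_cancel₀ hN0, C_1, one_mul]
  · rw [denom_eq hcm hg₀, hc]
    rw [← mul_assoc, ← C_mul, mul_inv_cancel₀ hc0, C_1, one_mul]
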